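/- \textbf{Theorem (High-probability generalization bound via differential privacy).} There is a universal constant $c>0$ such that the following holds. Let $\mathcal Z$ be a measurable space of examples, $\mathcal H$ a measurable space of hypotheses, $D$ a probability distribution on $\mathcal Z$, and $\ell:\mathcal H\times\mathcal Z\to\mathbb R$ a measurable loss with $|\ell|\le M$ for some real $M>0$. Let $N\ge 2$, and let $\mathcal A$ be a randomized learning algorithm that maps every sample $S=(z_1,\dots,z_N)\in\mathcal Z^N$ to a random hypothesis $\mathcal A(S)\in\mathcal H$ (formally, a Markov kernel from $\mathcal Z^N$ to $\mathcal H$). Suppose that $\mathcal A$ is $(\varepsilon,\delta)$-differentially private, where $\varepsilon,\delta\ge 0$: for every measurable $B\subset\mathcal H$ and all samples $S,S'\in\mathcal Z^N$ that differ in exactly one example, $$\mathbb P(\mathcal A(S)\in B)\le e^{\varepsilon}\,\mathbb P(\mathcal A(S')\in B)+\delta .$$ Put $\mathcal R(h)=\mathbb E_{Z\sim D}\,\ell(h,Z)$ and $\hat{\mathcal R}_S(h)=\frac1N\sum_{i=1}^N\ell(h,z_i)$, and let $\mathbb E_{\mathcal A}$ denote the expectation over the internal randomness of $\mathcal A$,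 with $S$ fixed. Then for every $\gamma\in(0,1)$, with probability at least $1-\gamma$ over the draw of $S\sim D^N$, $$\mathbb E_{\mathcal A}\mathcal R(\mathcal A(S))-\mathbb E_{\mathcal A}\hat{\mathcal R}_S(\mathcal A(S))\le c\left(M\bigl(1-e^{-\varepsilon}+e^{-\varepsilon}\delta\bigr)\log N\,\log\frac N\gamma+M\sqrt{\frac{\log(1/\gamma)}{N}}\right).$$ -/

import Mathlib

open MeasureTheory ProbabilityTheory

universe u v

noncomputable section

namespace DPGen

variable {Z : Type u} {H : Type v} {N : ℕ}

/-- Two samples of size `N` are neighbouring if they differ in exactly one example. -/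
def Neighboring (S S' : Fin N → Z) : Prop :=
  ∃ i, S i ≠ S' i ∧ ∀ j, j ≠ i → S j = S' j

variable [MeasurableSpace Z] [MeasurableSpace H]

/-- A randomized learning algorithm, given as a kernel `A` sending a sample `S` to the law of its
output hypothesis, is `(ε, δ)`-differentially private if
`P(A(S) ∈ B) ≤ e^ε P(A(S') ∈ B) + δ` for all measurable `B` and all neighbouring `S`, `S'`. -/
def IsDifferentiallyPrivate (A : Kernel (Fin N → Z) H) (ε δ : ℝ) : Prop :=
  ∀ S S' : Fin N → Z, Neighboring S S' → ∀ B : Set H, MeasurableSet B →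
    (A S).real B ≤ Real.exp ε * (A S').real B + δ

/-- The same notion in its logarithmic form,
`log ((P(A(S) ∈ B) - δ) / P(A(S') ∈ B)) ≤ ε`, with the logarithm taken in the extended reals
(so `log 0 = -∞`, a negative numerator counts as `0`, and `0 / 0 = 0`). -/
theorem isDifferentiallyPrivate_iff_log (A : Kernel (Fin N → Z) H) [IsMarkovKernel A]
    {ε δ : ℝ} (hδ : 0 ≤ δ) :
    IsDifferentiallyPrivate A ε δ ↔
      ∀ S S' : Fin N → Z, Neighboring S S' → ∀ B : Set H, MeasurableSet B →
        ENNReal.log ((A S B - ENNReal.ofReal δ) / A S' B) ≤ (ε : EReal) := by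
  unfold IsDifferentiallyPrivate
  refine forall_congr' fun S => forall_congr' fun S' => forall_congr' fun _ =>
    forall_congr' fun B => forall_congr' fun _ => ?_
  have hexp : (ε : EReal) = ENNReal.log (ENNReal.ofReal (Real.exp ε)) := by
    rw [ENNReal.log_ofReal_of_pos (Real.exp_pos ε), Real.log_exp]
  rw [hexp, ENNReal.log_le_log_iff,
    ENNReal.div_le_iff_le_mul (Or.inr ENNReal.ofReal_ne_top) (Or.inl (measure_ne_top _ _)),
    tsub_le_iff_right, ← ofReal_measureReal, ← ofReal_measureReal,
    ← ENNReal.ofReal_mul (Real.exp_pos ε).le, ← ENNReal.ofReal_add (by positivity) hδ,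
    ENNReal.ofReal_le_ofReal_iff (by positivity)]

/-- Expected risk `R(h) = E_{z ∼ D} ℓ(h, z)` of a hypothesis. -/
def risk (D : Measure Z) (ℓ : H → Z → ℝ) (h : H) : ℝ :=
  ∫ z, ℓ h z ∂D

/-- Empirical risk `(1 / N) ∑ i, ℓ(h, z_i)` of a hypothesis on the sample `S`. -/
def empiricalRisk (ℓ : H → Z → ℝ) (S : Fin N → Z) (h : H) : ℝ :=
  (1 / (N : ℝ)) * ∑ i, ℓ h (S i)

/-- `E_A R(A(S)) - E_A R̂_S(A(S))`, expectations over the internal randomness of `A` only. -/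
def expectedGap (D : Measure Z) (ℓ : H → Z → ℝ) (A : Kernel (Fin N → Z) H)
    (S : Fin N → Z) : ℝ :=
  (∫ h, risk D ℓ h ∂(A S)) - ∫ h, empiricalRisk ℓ S h ∂(A S)

end DPGen

end

noncomputable section

namespace DPGen

/-! Privacy enters only through stability. Put f(S, z) = E_A ℓ(A(S), z) and β = 1 - e^(-ε) +
e^(-ε)δ. Privacy bounds by β the change in the probability of any event when one example is
replaced, so f changes by at most 2Mβ (`IsDifferentiallyPrivate.abs_integral_sub_le`). What remains
is a concentration bound for uniformly stable real-valued predictions (`measure_gap_ge_le`).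

Replacing the i-th example by a fixed point z₀ in the sample, but not at the point of evaluation,
makes the i-th term of the gap a function g_i of mean zero in z_i when the other coordinates are
frozen, and only weakly dependent on those. Write g_i = (g_i - E[g_i | z_i]) + E[g_i | z_i]. The
second parts sum to independent, centred, bounded variables, which give the M√(log(1/γ)/N) term.

The first parts are handled by halving the coordinate set. For i in one half, with z₂ the other
half, insert E[g_i | z_i, z₂]. For frozen z₂, g_i - E[g_i | z_i, z₂] is the same problem on half the
coordinates. Given z₂, the variables E[g_i | z_i, z₂] - E[g_i | z_i] are independent and centred,
and for fixed z_i each is sub-Gaussian in z₂ by McDiarmid. So each level costs order nβ', with β'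
the weak-dependence constant, and there are about log₂ n levels (`lexp_merge`, `lexp_centred_le`).

Size is measured by the radius a in E exp(X/a - 1) ≤ 1. Convexity of exp makes radii add, even for
dependent variables (`lexp_div_add`). -/

/-- The exponential moment `E exp X`, as an extended nonnegative real. -/
def lexp {Ω : Type*} [MeasurableSpace Ω] (μ : Measure Ω) (X : Ω → ℝ) : ENNReal :=
  ∫⁻ ω, ENNReal.ofReal (Real.exp (X ω)) ∂μ

/-! ### Exponential moments on one probability space. -/

section Generic

variable {Ω : Type*} [MeasurableSpace Ω] {μ : Measure Ω}

theorem integrable_of_abs_le [IsFiniteMeasure μ] {f : Ω → ℝ} (hf : Measurable f) {B : ℝ}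
    (hB : ∀ ω, |f ω| ≤ B) : Integrable f μ :=
  Integrable.of_bound hf.aestronglyMeasurable B (Filter.Eventually.of_forall hB)

theorem abs_integral_le_of_abs_le [IsProbabilityMeasure μ] {f : Ω → ℝ} {B : ℝ}
    (hB : ∀ ω, |f ω| ≤ B) : |∫ ω, f ω ∂μ| ≤ B := by
  have := norm_integral_le_of_norm_le_const (μ := μ) (f := f) (Filter.Eventually.of_forall hB)
  simpa using this

theorem lexp_mono {X Y : Ω → ℝ} (h : ∀ ω, X ω ≤ Y ω) : lexp μ X ≤ lexp μ Y :=
  lintegral_mono fun ω => ENNReal.ofReal_le_ofReal (Real.exp_le_exp.2 (h ω))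

theorem lexp_const [IsProbabilityMeasure μ] (c : ℝ) :
    lexp μ (fun _ => c) = ENNReal.ofReal (Real.exp c) := by
  simp [lexp]

theorem lexp_add_const (X : Ω → ℝ) (c : ℝ) :
    lexp μ (fun ω => X ω + c) = lexp μ X * ENNReal.ofReal (Real.exp c) := by
  unfold lexp
  rw [← lintegral_mul_const' _ _ ENNReal.ofReal_ne_top]
  refine lintegral_congr fun ω => ?_
  rw [← ENNReal.ofReal_mul (Real.exp_pos _).le, ← Real.exp_add]

theorem lexp_sub_const_le_one {X : Ω → ℝ} {c : ℝ} (h : lexp μ X ≤ ENNReal.ofReal (Real.exp c)) :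
    lexp μ (fun ω => X ω - c) ≤ 1 := by
  simp only [sub_eq_add_neg, lexp_add_const]
  calc _ ≤ ENNReal.ofReal (Real.exp c) * ENNReal.ofReal (Real.exp (-c)) := by gcongr
    _ = 1 := by
      rw [← ENNReal.ofReal_mul (Real.exp_pos _).le, ← Real.exp_add]; simp

theorem integrable_exp_of_abs_le [IsFiniteMeasure μ] {X : Ω → ℝ} (hX : Measurable X) {B : ℝ}
    (hB : ∀ ω, |X ω| ≤ B) : Integrable (fun ω => Real.exp (X ω)) μ :=
  integrable_of_abs_le (B := Real.exp B) (by fun_prop) fun ω => by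
    rw [abs_of_pos (Real.exp_pos _)]
    exact Real.exp_le_exp.2 ((le_abs_self _).trans (hB ω))

theorem lexp_eq_ofReal_integral [IsFiniteMeasure μ] {X : Ω → ℝ} (hX : Measurable X) {B : ℝ}
    (hB : ∀ ω, |X ω| ≤ B) : lexp μ X = ENNReal.ofReal (∫ ω, Real.exp (X ω) ∂μ) :=
  (ofReal_integral_eq_lintegral_ofReal (integrable_exp_of_abs_le hX hB)
    (Filter.Eventually.of_forall fun _ => (Real.exp_pos _).le)).symm

/-- Exponential moments bounded by one are preserved by convex combinations. -/
theorem lexp_convex {X Y : Ω → ℝ} (hX : Measurable X) {a b : ℝ}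
    (ha : 0 ≤ a) (hb : 0 ≤ b) (hab : a + b = 1) (h1 : lexp μ X ≤ 1) (h2 : lexp μ Y ≤ 1) :
    lexp μ (fun ω => a * X ω + b * Y ω) ≤ 1 := by
  calc lexp μ (fun ω => a * X ω + b * Y ω)
      ≤ ∫⁻ ω, (ENNReal.ofReal a * ENNReal.ofReal (Real.exp (X ω))
          + ENNReal.ofReal b * ENNReal.ofReal (Real.exp (Y ω))) ∂μ := by
        refine lintegral_mono fun ω => ?_
        rw [← ENNReal.ofReal_mul ha, ← ENNReal.ofReal_mul hb,
          ← ENNReal.ofReal_add (by positivity) (by positivity)]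
        exact ENNReal.ofReal_le_ofReal
          (convexOn_exp.2 (Set.mem_univ (X ω)) (Set.mem_univ (Y ω)) ha hb hab)
    _ = ENNReal.ofReal a * lexp μ X + ENNReal.ofReal b * lexp μ Y := by
        rw [lintegral_add_left (by fun_prop), lintegral_const_mul' _ _ ENNReal.ofReal_ne_top,
          lintegral_const_mul' _ _ ENNReal.ofReal_ne_top]
        rfl
    _ ≤ ENNReal.ofReal a * 1 + ENNReal.ofReal b * 1 := by gcongr
    _ = 1 := by
        rw [mul_one, mul_one, ← ENNReal.ofReal_add ha hb, hab, ENNReal.ofReal_one]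

/-- Triangle inequality for radii: (X + Y)/(a + b) is the convex combination of X/a and Y/b with
weights a/(a + b) and b/(a + b). -/
theorem lexp_div_add {X Y : Ω → ℝ} (hX : Measurable X) {a b : ℝ}
    (ha : 0 < a) (hb : 0 < b) (h1 : lexp μ (fun ω => X ω / a - 1) ≤ 1)
    (h2 : lexp μ (fun ω => Y ω / b - 1) ≤ 1) :
    lexp μ (fun ω => (X ω + Y ω) / (a + b) - 1) ≤ 1 := by
  have := lexp_convex (μ := μ) (a := a / (a + b)) (b := b / (a + b)) (by fun_prop) (by positivity)
    (by positivity) (by field_simp) h1 h2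
  convert this using 3 with ω
  field_simp
  ring

/-- For |x| ≤ 1 this is e^x ≤ 1 + x + x²; for x ≤ -1, e^x ≤ 1 ≤ x + 1 + x²; for x ≥ 1, x ≤ x². On
taking expectations the linear term vanishes for a centred variable. -/
theorem exp_le_self_add_exp_sq (x : ℝ) : Real.exp x ≤ x + Real.exp (x ^ 2) := by
  rcases le_total |x| 1 with h | h
  · have h1 := abs_le.1 (Real.abs_exp_sub_one_sub_id_le h)
    have h2 := Real.add_one_le_exp (x ^ 2)
    linarith [h1.2]
  · rcases le_abs'.1 h with h' | h'
    · have h2 := Real.add_one_le_exp (x ^ 2)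
      have h3 : Real.exp x ≤ 1 := Real.exp_le_one_iff.2 (by linarith)
      nlinarith
    · have : Real.exp x ≤ Real.exp (x ^ 2) := Real.exp_le_exp.2 (by nlinarith)
      linarith

theorem lexp_le_lexp_sq [IsProbabilityMeasure μ] {X : Ω → ℝ} (hX : Measurable X) {B : ℝ}
    (hB : ∀ ω, |X ω| ≤ B) (h0 : ∫ ω, X ω ∂μ = 0) : lexp μ X ≤ lexp μ (fun ω => X ω ^ 2) := by
  have hB2 : ∀ ω, |X ω ^ 2| ≤ B ^ 2 := fun ω => by
    rw [abs_pow]; exact pow_le_pow_left₀ (abs_nonneg _) (hB ω) 2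
  have hX2 : Measurable fun ω => X ω ^ 2 := by fun_prop
  rw [lexp_eq_ofReal_integral hX hB, lexp_eq_ofReal_integral hX2 hB2]
  refine ENNReal.ofReal_le_ofReal ?_
  calc ∫ ω, Real.exp (X ω) ∂μ ≤ ∫ ω, (X ω + Real.exp (X ω ^ 2)) ∂μ :=
        integral_mono (integrable_exp_of_abs_le hX hB)
          ((integrable_of_abs_le hX hB).add (integrable_exp_of_abs_le hX2 hB2))
          fun ω => exp_le_self_add_exp_sq _
    _ = _ := by
        rw [integral_add (integrable_of_abs_le hX hB) (integrable_exp_of_abs_le hX2 hB2), h0, zero_add]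

theorem lexp_pi {ι : Type*} [Fintype ι] (P : ι → Measure Ω) [∀ i, IsProbabilityMeasure (P i)]
    {X : ι → Ω → ℝ} (hX : ∀ i, Measurable (X i)) {B : ℝ} (hB : ∀ i ω, |X i ω| ≤ B) :
    lexp (Measure.pi P) (fun z => ∑ i, X i (z i)) = ∏ i, lexp (P i) (X i) := by
  have hS : ∀ z : ι → Ω, |∑ i, X i (z i)| ≤ Fintype.card ι * B := fun z => by
    refine (Finset.abs_sum_le_sum_abs _ _).trans ((Finset.sum_le_sum fun i _ => hB i (z i)).trans ?_)
    simp
  rw [lexp_eq_ofReal_integral (by fun_prop) hS]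
  simp only [Real.exp_sum]
  rw [integral_fintype_prod_eq_prod (f := fun i x => Real.exp (X i x)),
    ENNReal.ofReal_prod_of_nonneg fun i _ => integral_nonneg fun _ => (Real.exp_pos _).le]
  exact Finset.prod_congr rfl fun i _ => (lexp_eq_ofReal_integral (hX i) (hB i)).symm

theorem lexp_gaussian_sq_div_four :
    lexp (gaussianReal 0 1) (fun x => x ^ 2 / 4) ≤ 2 := by
  have hi : ∀ x : ℝ, gaussianPDF 0 1 x * ENNReal.ofReal (Real.exp (x ^ 2 / 4))
      = ENNReal.ofReal ((Real.sqrt (2 * Real.pi))⁻¹ * Real.exp (-(1 / 4) * x ^ 2)) := fun x => by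
    rw [gaussianPDF, gaussianPDFReal, ← ENNReal.ofReal_mul (by positivity), mul_assoc,
      ← Real.exp_add]
    congr 2
    · simp
    · congr 1; simp; ring
  rw [lexp, gaussianReal_of_var_ne_zero _ one_ne_zero,
    lintegral_withDensity_eq_lintegral_mul _ (measurable_gaussianPDF 0 1) (by fun_prop)]
  simp only [Pi.mul_apply, hi]
  rw [← ofReal_integral_eq_lintegral_ofReal
    ((integrable_exp_neg_mul_sq (by norm_num : (0:ℝ) < 1 / 4)).const_mul _)
    (Filter.Eventually.of_forall fun x => by positivity), integral_const_mul, integral_gaussian]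
  refine ENNReal.ofReal_le_of_le_toReal ?_
  rw [← Real.sqrt_inv, ← Real.sqrt_mul (by positivity)]
  refine Real.sqrt_le_iff.2 ⟨by simp, ?_⟩
  have := Real.pi_pos
  field_simp
  norm_num

/-- A sub-Gaussian random variable has exponentially integrable square. -/
theorem lexp_sq_le_two [IsProbabilityMeasure μ] {F : Ω → ℝ} (hF : Measurable F) {v s : ℝ}
    (hs : 0 ≤ s) (hv : s * v ≤ 1 / 4)
    (h : ∀ t, lexp μ (fun ω => t * F ω) ≤ ENNReal.ofReal (Real.exp (v * t ^ 2 / 2))) :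
    lexp μ (fun ω => s * F ω ^ 2) ≤ 2 := by
  -- Gaussian linearization: exp(s y²) = E exp(√(2s) ξ y) with ξ standard normal. After exchanging
  -- integrals the sub-Gaussian bound applies at t = √(2s) ξ, leaving E exp(ξ²/4) = √2.
  have key : ∀ y : ℝ, ENNReal.ofReal (Real.exp (s * y ^ 2))
      = ∫⁻ x, ENNReal.ofReal (Real.exp (Real.sqrt (2 * s) * x * y)) ∂(gaussianReal 0 1) := fun y => by
    have h1 := congrFun (mgf_id_gaussianReal (μ := 0) (v := 1)) (Real.sqrt (2 * s) * y)
    have h2 : Integrable (fun x => Real.exp (Real.sqrt (2 * s) * x * y)) (gaussianReal 0 1) := by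
      have := integrable_exp_mul_gaussianReal (μ := 0) (v := 1) (Real.sqrt (2 * s) * y)
      convert this using 2 with x
      ring_nf
    rw [← ofReal_integral_eq_lintegral_ofReal h2
      (Filter.Eventually.of_forall fun _ => (Real.exp_pos _).le)]
    congr 1
    simp only [mgf, id] at h1
    calc Real.exp (s * y ^ 2) = Real.exp (0 * (Real.sqrt (2 * s) * y)
          + (1 : NNReal) * (Real.sqrt (2 * s) * y) ^ 2 / 2) := by
            rw [mul_pow, Real.sq_sqrt (by positivity)]; congr 1; simp; ring
      _ = _ := by rw [← h1]; congr 1; ext x; ring_nf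
  unfold lexp
  simp only [key]
  rw [lintegral_lintegral_swap (Measurable.aemeasurable (by fun_prop))]
  refine le_trans (lintegral_mono fun x => ?_) lexp_gaussian_sq_div_four
  refine (h (Real.sqrt (2 * s) * x)).trans (ENNReal.ofReal_le_ofReal (Real.exp_le_exp.2 ?_))
  rw [mul_pow, Real.sq_sqrt (by positivity)]
  nlinarith [sq_nonneg x]

theorem lexp_hoeffding [IsProbabilityMeasure μ] {F : Ω → ℝ} (hF : Measurable F) {β : ℝ}
    (hβ : ∀ ω ω', |F ω - F ω'| ≤ β) (t : ℝ) :
    lexp μ (fun ω => t * (F ω - ∫ ω', F ω' ∂μ)) ≤ ENNReal.ofReal (Real.exp (β ^ 2 * t ^ 2 / 2)) := by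
  obtain ⟨ω₀⟩ := nonempty_of_isProbabilityMeasure μ
  have hβ0 : 0 ≤ β := (abs_nonneg _).trans (hβ ω₀ ω₀)
  -- The interval is centred at an arbitrary value of F, so its length is 2β and the variance proxy
  -- β² rather than β²/4; only constants suffer.
  have h := hasSubgaussianMGF_of_mem_Icc (μ := μ) (X := F) (a := F ω₀ - β) (b := F ω₀ + β)
    hF.aemeasurable (Filter.Eventually.of_forall fun ω => by
      have := abs_le.1 (hβ ω ω₀)
      constructor <;> linarith)
  unfold lexp
  rw [← ofReal_integral_eq_lintegral_ofReal (h.integrable_exp_mul t)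
    (Filter.Eventually.of_forall fun _ => (Real.exp_pos _).le)]
  refine ENNReal.ofReal_le_ofReal ((h.mgf_le t).trans (Real.exp_le_exp.2 (le_of_eq ?_)))
  have : F ω₀ + β - (F ω₀ - β) = 2 * β := by ring
  simp [this, abs_of_nonneg hβ0]

end Generic

/-! ### Conditionally independent sums and splitting of coordinates. -/

section Split

variable {Z : Type u} [MeasurableSpace Z] {Ω : Type*} [MeasurableSpace Ω]

theorem lexp_prod_symm {Ω' : Type*} [MeasurableSpace Ω'] {P : Measure Ω} {Q : Measure Ω'}
    [SFinite P] [SFinite Q] {X : Ω × Ω' → ℝ} (hX : Measurable X) :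
    lexp (P.prod Q) X = ∫⁻ y, lexp P (fun x => X (x, y)) ∂Q :=
  lintegral_prod_symm' _ (by fun_prop)

theorem lexp_prod {Ω' : Type*} [MeasurableSpace Ω'] {P : Measure Ω} {Q : Measure Ω'}
    [SFinite P] [SFinite Q] {X : Ω × Ω' → ℝ} (hX : Measurable X) :
    lexp (P.prod Q) X = ∫⁻ x, lexp Q (fun y => X (x, y)) ∂P :=
  lintegral_prod _ (by fun_prop)

theorem lexp_prod_swap {Ω' : Type*} [MeasurableSpace Ω'] {P : Measure Ω} {Q : Measure Ω'}
    [SFinite P] [SFinite Q] (X : Ω' × Ω → ℝ) :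
    lexp (P.prod Q) (fun y => X y.swap) = lexp (Q.prod P) X :=
  lintegral_prod_swap fun y => ENNReal.ofReal (Real.exp (X y))

/-- Jensen for the average of the n·Y_i: no independence is needed, at the price of the factor n in
the hypothesis. -/
theorem lexp_sum_le_two {ι : Type*} [Fintype ι] [Nonempty ι] {P : Measure Ω} {Y : ι → Ω → ℝ}
    (hY : ∀ i, Measurable (Y i))
    (h : ∀ i, lexp P (fun ω => Fintype.card ι * Y i ω) ≤ 2) :
    lexp P (fun ω => ∑ i, Y i ω) ≤ 2 := by
  have hn : (0 : ℝ) < Fintype.card ι := by exact_mod_cast Fintype.card_pos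
  calc lexp P (fun ω => ∑ i, Y i ω)
      ≤ ∫⁻ ω, ∑ i, ENNReal.ofReal (1 / Fintype.card ι)
          * ENNReal.ofReal (Real.exp (Fintype.card ι * Y i ω)) ∂P := by
        refine lintegral_mono fun ω => ?_
        have := convexOn_exp.map_sum_le (t := (Finset.univ : Finset ι))
          (w := fun _ => 1 / (Fintype.card ι : ℝ)) (p := fun i => Fintype.card ι * Y i ω)
          (fun _ _ => by positivity) (by simp) (fun _ _ => Set.mem_univ _)
        simp only [smul_eq_mul] at this
        simp only [← ENNReal.ofReal_mul (by positivity : (0 : ℝ) ≤ 1 / Fintype.card ι)]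
        rw [← ENNReal.ofReal_sum_of_nonneg fun _ _ => by positivity]
        refine ENNReal.ofReal_le_ofReal (le_trans (le_of_eq ?_) this)
        congr 1
        refine Finset.sum_congr rfl fun i _ => ?_
        field_simp
    _ = ∑ i, ENNReal.ofReal (1 / Fintype.card ι)
          * lexp P (fun ω => Fintype.card ι * Y i ω) := by
        rw [lintegral_finsetSum _ fun i _ => by fun_prop]
        exact Finset.sum_congr rfl fun i _ => lintegral_const_mul' _ _ ENNReal.ofReal_ne_top
    _ ≤ ∑ _i : ι, ENNReal.ofReal (1 / Fintype.card ι) * 2 := by gcongr with i; exact h i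
    _ = 2 := by
        rw [← Finset.sum_mul, ← ENNReal.ofReal_sum_of_nonneg fun _ _ => by positivity]
        simp

/-- Sums of conditionally independent, conditionally centred variables, each of which is
sub-Gaussian as a function of the conditioning variable. -/
theorem lexp_sum_cond_indep {κ : Type*} [Fintype κ] [Nonempty κ] (D : Measure Z)
    [IsProbabilityMeasure D] (Q : Measure Ω) [IsProbabilityMeasure Q]
    {h : κ → Z × Ω → ℝ} (hm : ∀ i, Measurable (h i)) {B : ℝ} (hB : ∀ i y, |h i y| ≤ B)
    (h0 : ∀ i ω, ∫ x, h i (x, ω) ∂D = 0) {v c : ℝ} (hc : Fintype.card κ * c ^ 2 * v ≤ 1 / 4)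
    (hv : ∀ i x t, lexp Q (fun ω => t * h i (x, ω)) ≤ ENNReal.ofReal (Real.exp (v * t ^ 2 / 2))) :
    lexp ((Measure.pi fun _ : κ => D).prod Q) (fun y => ∑ i, c * h i (y.1 i, y.2)) ≤ 2 := by
  have hB' : ∀ i y, |c * h i y| ≤ |c| * B := fun i y => by
    rw [abs_mul]; exact mul_le_mul_of_nonneg_left (hB i y) (abs_nonneg c)
  have hB2 : ∀ i y, |(c * h i y) ^ 2| ≤ (|c| * B) ^ 2 := fun i y => by
    rw [abs_pow]; exact pow_le_pow_left₀ (abs_nonneg _) (hB' i y) 2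
  -- With ω frozen, independence factors the moment and each centred factor is replaced by its
  -- square. Then the roles swap: Jensen isolates one index, z is frozen, and the sub-Gaussian bound
  -- in ω is used.
  calc _ ≤ lexp ((Measure.pi fun _ : κ => D).prod Q)
        (fun y => ∑ i, (c * h i (y.1 i, y.2)) ^ 2) := by
        rw [lexp_prod_symm (by fun_prop), lexp_prod_symm (by fun_prop)]
        refine lintegral_mono fun ω => ?_
        rw [lexp_pi (X := fun i x => c * h i (x, ω)) _ (fun i => by fun_prop) (B := |c| * B)
            (fun i x => hB' i _),
          lexp_pi (X := fun i x => (c * h i (x, ω)) ^ 2) _ (fun i => by fun_prop)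
            (B := (|c| * B) ^ 2) (fun i x => hB2 i _)]
        refine Finset.prod_le_prod' fun i _ => lexp_le_lexp_sq (by fun_prop) (B := |c| * B)
          (fun x => hB' i _) ?_
        rw [integral_const_mul, h0, mul_zero]
    _ ≤ 2 := by
        refine lexp_sum_le_two (fun i => by fun_prop) fun i => ?_
        rw [lexp_prod (by fun_prop)]
        calc _ ≤ ∫⁻ _ : κ → Z, (2 : ENNReal) ∂(Measure.pi fun _ : κ => D) := by
              refine lintegral_mono fun z => ?_
              have := lexp_sq_le_two (μ := Q) (F := fun ω => h i (z i, ω)) (by fun_prop)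
                (v := v) (s := Fintype.card κ * c ^ 2) (by positivity) hc (hv i (z i))
              simpa only [mul_pow, mul_assoc] using this
          _ = 2 := by simp

variable {ι : Type}

/-- Assemble a point of `ι → Z` from its coordinates in and outside `p`. -/
def glue (p : ι → Prop) [DecidablePred p] (y : ({i // p i} → Z) × ({i // ¬p i} → Z)) : ι → Z :=
  (MeasurableEquiv.piEquivPiSubtypeProd (fun _ : ι => Z) p).symm y

variable (p : ι → Prop) [DecidablePred p]

theorem glue_apply (y : ({i // p i} → Z) × ({i // ¬p i} → Z)) (i : ι) :
    glue p y i = if h : p i then y.1 ⟨i, h⟩ else y.2 ⟨i, h⟩ := rfl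

@[simp] theorem glue_coe_left (y : ({i // p i} → Z) × ({i // ¬p i} → Z)) (i : {i // p i}) :
    glue p y i = y.1 i := by simp [glue_apply, i.2]

@[simp] theorem glue_coe_right (y : ({i // p i} → Z) × ({i // ¬p i} → Z)) (i : {i // ¬p i}) :
    glue p y i = y.2 i := by simp [glue_apply, i.2]

@[fun_prop] theorem measurable_glue : Measurable (glue (Z := Z) p) :=
  (MeasurableEquiv.piEquivPiSubtypeProd (fun _ : ι => Z) p).symm.measurable

theorem glue_update_left [DecidableEq ι] (y : ({i // p i} → Z) × ({i // ¬p i} → Z))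
    (i : {i // p i}) (x : Z) :
    glue p (Function.update y.1 i x, y.2) = Function.update (glue p y) i x := by
  ext j
  by_cases hj : p j
  · by_cases hij : j = i
    · subst hij; simp
    · have : (⟨j, hj⟩ : {i // p i}) ≠ i := fun h => hij (congrArg Subtype.val h)
      simp [glue_apply, hj, Function.update_of_ne, hij, this]
  · have hij : j ≠ i := fun h => hj (h ▸ i.2)
    simp [glue_apply, hj, Function.update_of_ne hij]

theorem glue_update_right [DecidableEq ι] (y : ({i // p i} → Z) × ({i // ¬p i} → Z))
    (i : {i // ¬p i}) (x : Z) :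
    glue p (y.1, Function.update y.2 i x) = Function.update (glue p y) i x := by
  ext j
  by_cases hj : p j
  · have hij : j ≠ i := fun h => i.2 (h ▸ hj)
    simp [glue_apply, hj, Function.update_of_ne hij]
  · by_cases hij : j = i
    · subst hij; simp
    · have : (⟨j, hj⟩ : {i // ¬p i}) ≠ i := fun h => hij (congrArg Subtype.val h)
      simp [glue_apply, hj, Function.update_of_ne, hij, this]

variable [Fintype ι] (D : Measure Z) [IsProbabilityMeasure D]

theorem measurePreserving_glue :
    MeasurePreserving (glue p)
      ((Measure.pi fun _ : {i // p i} => D).prod (Measure.pi fun _ : {i // ¬p i} => D))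
      (Measure.pi fun _ : ι => D) :=
  (measurePreserving_piEquivPiSubtypeProd (fun _ : ι => D) p).symm

theorem lexp_pi_eq_lexp_glue (X : (ι → Z) → ℝ) :
    lexp (Measure.pi fun _ : ι => D) X =
      lexp ((Measure.pi fun _ : {i // p i} => D).prod (Measure.pi fun _ : {i // ¬p i} => D))
        (fun y => X (glue p y)) :=
  ((measurePreserving_glue p D).lintegral_comp_emb
    (MeasurableEquiv.piEquivPiSubtypeProd (fun _ : ι => Z) p).symm.measurableEmbedding _).symm

theorem integral_pi_eq_integral_glue (X : (ι → Z) → ℝ) :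
    ∫ z, X z ∂(Measure.pi fun _ : ι => D) =
      ∫ y, X (glue p y)
        ∂((Measure.pi fun _ : {i // p i} => D).prod (Measure.pi fun _ : {i // ¬p i} => D)) :=
  ((measurePreserving_glue p D).integral_comp
    (MeasurableEquiv.piEquivPiSubtypeProd (fun _ : ι => Z) p).symm.measurableEmbedding _).symm

end Split

/-! ### McDiarmid's inequality by induction on the number of coordinates. -/

/-- Exponential-moment form of McDiarmid's bounded differences inequality. -/
theorem lexp_mcdiarmid {Z : Type u} [MeasurableSpace Z] (D : Measure Z) [IsProbabilityMeasure D]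
    (n : ℕ) : ∀ (ι : Type) [Fintype ι] [DecidableEq ι], Fintype.card ι = n →
      ∀ F : (ι → Z) → ℝ, Measurable F → ∀ B, (∀ z, |F z| ≤ B) →
      ∀ β, (∀ z i x, |F (Function.update z i x) - F z| ≤ β) → ∀ t : ℝ,
      lexp (Measure.pi fun _ : ι => D) (fun z => t * (F z - ∫ w, F w ∂(Measure.pi fun _ : ι => D)))
        ≤ ENNReal.ofReal (Real.exp (n * β ^ 2 * t ^ 2 / 2)) := by
  induction n with
  | zero =>
    intro ι _ _ hι F hF B hB β hβ t
    have := Fintype.card_eq_zero_iff.1 hι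
    have h := lexp_hoeffding (μ := Measure.pi fun _ : ι => D) hF (β := 0)
      (fun z z' => by rw [Subsingleton.elim z z']; simp) t
    simpa using h
  | succ n ih =>
    intro ι _ _ hι F hF B hB β hβ t
    have : Nonempty ι := Fintype.card_pos_iff.1 (by omega)
    obtain ⟨i₀⟩ := ‹Nonempty ι›
    classical
    obtain ⟨p, hp⟩ : ∃ p : ι → Prop, ∀ i, p i ↔ i = i₀ := ⟨_, fun _ => Iff.rfl⟩
    have hcard : Fintype.card {i // ¬p i} = n := by
      rw [Fintype.card_subtype_compl, hι]; simp [hp]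
    set P₁ := Measure.pi fun _ : {i // p i} => D
    set P₂ := Measure.pi fun _ : {i // ¬p i} => D
    -- One martingale step: F - G is controlled by Hoeffding in the coordinate i₀ alone, while G
    -- inherits the differences β and falls to the induction hypothesis.
    set G : ({i // ¬p i} → Z) → ℝ := fun z₂ => ∫ z₁, F (glue p (z₁, z₂)) ∂P₁ with hG
    have hGm : Measurable G := by
      have : StronglyMeasurable fun y : ({i // ¬p i} → Z) × ({i // p i} → Z) =>
        F (glue p (y.2, y.1)) := (by fun_prop : Measurable _).stronglyMeasurable
      exact this.integral_prod_right'.measurable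
    have hmF : ∀ z₂, Measurable fun z₁ => F (glue p (z₁, z₂)) := fun z₂ => by fun_prop
    have hGB : ∀ z₂, |G z₂| ≤ B := fun z₂ => abs_integral_le_of_abs_le fun _ => hB _
    have hGβ : ∀ z i x, |G (Function.update z i x) - G z| ≤ β := fun z i x => by
      rw [hG]
      simp only
      rw [← integral_sub (integrable_of_abs_le (hmF _) fun _ => hB _)
        (integrable_of_abs_le (hmF _) fun _ => hB _)]
      refine abs_integral_le_of_abs_le fun z₁ => ?_
      rw [glue_update_right p (z₁, z)]
      exact hβ _ _ _
    have hEG : ∫ z₂, G z₂ ∂P₂ = ∫ w, F w ∂(Measure.pi fun _ : ι => D) := by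
      rw [integral_pi_eq_integral_glue p D,
        integral_prod_symm _ (integrable_of_abs_le (by fun_prop) fun _ => hB _)]
    have hosc : ∀ z₂ z₁ z₁', |F (glue p (z₁, z₂)) - F (glue p (z₁', z₂))| ≤ β := fun z₂ z₁ z₁' => by
      have : z₁ = Function.update z₁' ⟨i₀, (hp i₀).2 rfl⟩ (z₁ ⟨i₀, (hp i₀).2 rfl⟩) := by
        ext ⟨j, hj⟩
        obtain rfl : j = i₀ := (hp j).1 hj
        simp
      rw [this, glue_update_left p (z₁', z₂)]
      exact hβ _ _ _
    rw [lexp_pi_eq_lexp_glue p D, lexp_prod_symm (by fun_prop), ← hEG]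
    calc _ = ∫⁻ z₂, lexp P₁ (fun z₁ => t * (F (glue p (z₁, z₂)) - G z₂))
          * ENNReal.ofReal (Real.exp (t * (G z₂ - ∫ z₂, G z₂ ∂P₂))) ∂P₂ := by
          refine lintegral_congr fun z₂ => ?_
          rw [← lexp_add_const]
          refine congrArg (lexp P₁) (funext fun z₁ => ?_)
          ring
      _ ≤ ∫⁻ z₂, ENNReal.ofReal (Real.exp (β ^ 2 * t ^ 2 / 2))
          * ENNReal.ofReal (Real.exp (t * (G z₂ - ∫ z₂, G z₂ ∂P₂))) ∂P₂ := by
          refine lintegral_mono fun z₂ => ?_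
          gcongr
          exact lexp_hoeffding (hmF z₂) (hosc z₂) t
      _ = ENNReal.ofReal (Real.exp (β ^ 2 * t ^ 2 / 2))
          * lexp P₂ (fun z₂ => t * (G z₂ - ∫ z₂, G z₂ ∂P₂)) :=
          lintegral_const_mul' _ _ ENNReal.ofReal_ne_top
      _ ≤ ENNReal.ofReal (Real.exp (β ^ 2 * t ^ 2 / 2))
          * ENNReal.ofReal (Real.exp (n * β ^ 2 * t ^ 2 / 2)) := by
          gcongr
          exact ih _ hcard G hGm B hGB β hGβ t
      _ = _ := by
          rw [← ENNReal.ofReal_mul (Real.exp_pos _).le, ← Real.exp_add]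
          congr 2
          push_cast
          ring

/-! ### The halving recursion for weakly dependent sums. -/

section Stability

variable {Z : Type u} [MeasurableSpace Z] (D : Measure Z)

/-- The sum of the `g i`, each recentred by its conditional expectation given the `i`-th
coordinate. -/
def centred {ι : Type} [Fintype ι] [DecidableEq ι] (g : ι → (ι → Z) → ℝ) (z : ι → Z) : ℝ :=
  ∑ i, (g i z - ∫ w, g i (Function.update w i (z i)) ∂(Measure.pi fun _ : ι => D))

theorem two_le_ofReal_exp_one : (2 : ENNReal) ≤ ENNReal.ofReal (Real.exp 1) := by
  have : (2 : ENNReal) = ENNReal.ofReal 2 := by simp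
  rw [this]
  exact ENNReal.ofReal_le_ofReal (by have := Real.add_one_le_exp 1; linarith)

@[fun_prop] theorem measurable_centred [IsProbabilityMeasure D] {ι : Type} [Fintype ι]
    [DecidableEq ι] {g : ι → (ι → Z) → ℝ} (hg : ∀ i, Measurable (g i)) :
    Measurable (centred D g) := by
  refine Finset.measurable_fun_sum _ fun i _ => (hg i).sub ?_
  have h1 : Measurable fun q : Z × (ι → Z) => g i (Function.update q.2 i q.1) :=
    (hg i).comp (measurable_update'.comp (measurable_snd.prodMk measurable_fst))
  have h2 : Measurable fun x : Z =>
      ∫ w, g i (Function.update w i x) ∂(Measure.pi fun _ : ι => D) :=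
    h1.stronglyMeasurable.integral_prod_right'.measurable
  exact h2.comp (measurable_pi_apply i)

variable [IsProbabilityMeasure D]

/-- One level of the recursion, for the indices in one half κ. Radius a pays for the deviation from
the conditional expectation given z_i and the other half; (|κ| + |lam|)β pays for that expectation's
deviation from the one given z_i alone. -/
theorem lexp_merge {κ lam : Type} [Fintype κ] [Nonempty κ] [DecidableEq κ] [Fintype lam]
    [DecidableEq lam] {u : κ → (κ → Z) × (lam → Z) → ℝ} (hm : ∀ i, Measurable (u i))
    {B : ℝ} (hB : ∀ i y, |u i y| ≤ B)
    (h0 : ∀ i (y : (κ → Z) × (lam → Z)), ∫ x, u i (Function.update y.1 i x, y.2) ∂D = 0) {β : ℝ}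
    (hβ0 : 0 < β)
    (hβ : ∀ i y j x, |u i (y.1, Function.update y.2 j x) - u i y| ≤ β) {a : ℝ} (ha : 0 < a)
    (ih : ∀ z₂, lexp (Measure.pi fun _ : κ => D)
      (fun z₁ => centred D (fun i z => u i (z, z₂)) z₁ / a - 1) ≤ 1) :
    lexp ((Measure.pi fun _ : κ => D).prod (Measure.pi fun _ : lam => D))
      (fun y => (∑ i, (u i y - ∫ w, u i (Function.update w.1 i (y.1 i), w.2)
        ∂((Measure.pi fun _ : κ => D).prod (Measure.pi fun _ : lam => D))))
          / (a + (Fintype.card κ + Fintype.card lam) * β) - 1) ≤ 1 := by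
  set P₁ := Measure.pi fun _ : κ => D with hP₁
  set P₂ := Measure.pi fun _ : lam => D with hP₂
  have hn : (0 : ℝ) < Fintype.card κ := by exact_mod_cast Fintype.card_pos
  have hn' : (0 : ℝ) ≤ Fintype.card lam := by positivity
  set b : ℝ := (Fintype.card κ + Fintype.card lam) * β with hb
  have hb0 : 0 < b := by positivity
  set m : κ → Z × (lam → Z) → ℝ := fun i q => ∫ w, u i (Function.update w i q.1, q.2) ∂P₁ with hmdef
  have hum : ∀ i, Measurable fun q : (Z × (lam → Z)) × (κ → Z) =>
      u i (Function.update q.2 i q.1.1, q.1.2) := fun i =>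
    (hm i).comp ((measurable_update'.comp (measurable_snd.prodMk measurable_fst.fst)).prodMk
      measurable_fst.snd)
  have hmm : ∀ i, Measurable (m i) := fun i =>
    (hum i).stronglyMeasurable.integral_prod_right'.measurable
  have hmB : ∀ i q, |m i q| ≤ B := fun i q => abs_integral_le_of_abs_le fun _ => hB _ _
  set e : κ → Z → ℝ := fun i x => ∫ z₂, m i (x, z₂) ∂P₂ with he
  have hem : ∀ i, Measurable (e i) := fun i =>
    (hmm i).stronglyMeasurable.integral_prod_right'.measurable
  have heB : ∀ i x, |e i x| ≤ B := fun i x => abs_integral_le_of_abs_le fun _ => hmB _ _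
  have hm0 : ∀ i z₂, ∫ x, m i (x, z₂) ∂D = 0 := fun i z₂ => by
    have hsw : Measurable (Function.uncurry fun (x : Z) (w : κ → Z) =>
        u i (Function.update w i x, z₂)) :=
      (hum i).comp (f := fun q : Z × (κ → Z) => ((q.1, z₂), q.2)) (by fun_prop)
    simp only [hmdef]
    rw [integral_integral_swap (integrable_of_abs_le hsw fun _ => hB _ _)]
    simp [h0 i (_, z₂)]
  have he0 : ∀ i, ∫ x, e i x ∂D = 0 := fun i => by
    simp only [he]
    rw [integral_integral_swap (integrable_of_abs_le (hmm i) (hmB i))]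
    simp [hm0]
  have hfub : ∀ i x, ∫ w, u i (Function.update w.1 i x, w.2) ∂(P₁.prod P₂) = e i x := fun i x => by
    have h1 : Measurable fun w : (κ → Z) × (lam → Z) => u i (Function.update w.1 i x, w.2) :=
      (hum i).comp (f := fun w : (κ → Z) × (lam → Z) => ((x, w.2), w.1)) (by fun_prop)
    rw [integral_prod_symm _ (integrable_of_abs_le h1 fun _ => hB _ _)]
  simp only [hfub]
  have hcore : lexp (P₁.prod P₂)
      (fun y => (∑ i, (m i (y.1 i, y.2) - e i (y.1 i))) / b - 1) ≤ 1 := by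
    refine lexp_sub_const_le_one (le_trans ?_ two_le_ofReal_exp_one)
    have hmβ : ∀ i x z j x', |m i (x, Function.update z j x') - m i (x, z)| ≤ β := by
      intro i x z j x'
      have h1 : ∀ z, Measurable fun w : κ → Z => u i (Function.update w i x, z) := fun z =>
        (hum i).comp (f := fun w : κ → Z => ((x, z), w)) (by fun_prop)
      simp only [hmdef]
      rw [← integral_sub (integrable_of_abs_le (h1 _) fun _ => hB _ _)
        (integrable_of_abs_le (h1 _) fun _ => hB _ _)]
      exact abs_integral_le_of_abs_le fun w => hβ i (_, z) j x'
    have hc := lexp_sum_cond_indep (κ := κ) D P₂ (h := fun i q => m i q - e i q.1)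
      (fun i => (hmm i).sub ((hem i).comp measurable_fst)) (B := B + B)
      (fun i y => (abs_sub _ _).trans (add_le_add (hmB _ _) (heB _ _)))
      (fun i z₂ => by
        have h1 : Measurable fun x => m i (x, z₂) := (hmm i).comp (by fun_prop)
        simp only
        rw [integral_sub (integrable_of_abs_le h1 fun _ => hmB _ _)
          (integrable_of_abs_le (hem i) (heB i)), hm0, he0, sub_zero])
      -- The requirement is |κ||lam|β²/b² ≤ 1/4, which is AM-GM for b = (|κ| + |lam|)β.
      (v := Fintype.card lam * β ^ 2) (c := b⁻¹)
      (by
        rw [hb]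
        field_simp
        nlinarith [sq_nonneg ((Fintype.card κ : ℝ) - Fintype.card lam)])
      (fun i x t => lexp_mcdiarmid D _ lam rfl (fun z₂ => m i (x, z₂)) ((hmm i).comp (by fun_prop))
        B (fun _ => hmB _ _) β (fun z j x' => hmβ i x z j x') t)
    refine le_trans (le_of_eq ?_) hc
    congr 1
    ext y
    rw [Finset.sum_div]
    exact Finset.sum_congr rfl fun i _ => by rw [div_eq_inv_mul]
  have hmy : ∀ i, Measurable fun y : (κ → Z) × (lam → Z) => m i (y.1 i, y.2) := fun i =>
    (hmm i).comp (by fun_prop)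
  have hX : Measurable fun y : (κ → Z) × (lam → Z) => ∑ i, (u i y - m i (y.1 i, y.2)) := by
    fun_prop
  have hind : lexp (P₁.prod P₂)
      (fun y => (∑ i, (u i y - m i (y.1 i, y.2))) / a - 1) ≤ 1 := by
    rw [lexp_prod_symm (by fun_prop)]
    calc _ ≤ ∫⁻ _, (1 : ENNReal) ∂P₂ := lintegral_mono fun z₂ => ih z₂
      _ = 1 := by simp
  have := lexp_div_add hX ha hb0 hind hcore
  convert this using 5 with y
  rw [← Finset.sum_add_distrib]
  exact Finset.sum_congr rfl fun i _ => by ring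

/-- The halves have radii 2n₁β(k+1) + nβ and 2n₂β(k+1) + nβ, which add up to 2nβ(k+2). A single
coordinate contributes 0, its function being its own conditional expectation. -/
theorem lexp_centred_le (k : ℕ) : ∀ (ι : Type) [Fintype ι] [DecidableEq ι] [Nonempty ι],
    Fintype.card ι ≤ 2 ^ k → ∀ g : ι → (ι → Z) → ℝ, (∀ i, Measurable (g i)) →
    ∀ B, (∀ i z, |g i z| ≤ B) → (∀ i z, ∫ x, g i (Function.update z i x) ∂D = 0) →
    ∀ β, 0 < β → (∀ i j, j ≠ i → ∀ z x, |g i (Function.update z j x) - g i z| ≤ β) →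
    lexp (Measure.pi fun _ : ι => D)
      (fun z => centred D g z / (2 * Fintype.card ι * β * (k + 1)) - 1) ≤ 1 := by
  have base : ∀ (ι : Type) [Fintype ι] [DecidableEq ι], Fintype.card ι ≤ 1 →
      ∀ (g : ι → (ι → Z) → ℝ) (a : ℝ), lexp (Measure.pi fun _ : ι => D)
        (fun z => centred D g z / a - 1) ≤ 1 := by
    intro ι _ _ hι g a
    have := Fintype.card_le_one_iff_subsingleton.1 hι
    have h0 : ∀ z, centred D g z = 0 := fun z => by
      refine Finset.sum_eq_zero fun i _ => ?_
      have : ∀ w : ι → Z, Function.update w i (z i) = z := fun w => by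
        ext j
        rw [Subsingleton.elim j i, Function.update_self]
      simp [this]
    simp only [h0, zero_div, zero_sub]
    rw [lexp_const]
    exact ENNReal.ofReal_le_one.2 (Real.exp_le_one_iff.2 (by norm_num))
  induction k with
  | zero =>
    intro ι _ _ _ hι g _ _ _ _ β _ _
    exact base ι (by simpa using hι) g _
  | succ k ih =>
    intro ι _ _ _ hι g hg B hB h0 β hβ0 hβ
    by_cases h1 : Fintype.card ι ≤ 1
    · exact base ι h1 g _
    classical
    obtain ⟨p, s, hs, hp⟩ : ∃ (p : ι → Prop) (s : Finset ι),
        s.card = Fintype.card ι / 2 ∧ ∀ i, i ∈ s ↔ p i := by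
      obtain ⟨s, -, hs⟩ := Finset.exists_subset_card_eq (s := (Finset.univ : Finset ι))
        (n := Fintype.card ι / 2) (by rw [Finset.card_univ]; omega)
      exact ⟨_, s, hs, fun _ => Iff.rfl⟩
    have hc₁ : Fintype.card {i // p i} = Fintype.card ι / 2 := by
      rw [Fintype.card_of_subtype s hp, hs]
    have hc₂ : Fintype.card {i // ¬p i} = Fintype.card ι - Fintype.card ι / 2 := by
      rw [Fintype.card_subtype_compl, hc₁]
    have hk : 2 ^ (k + 1) = 2 * 2 ^ k := by ring
    have hn₁ : Nonempty {i // p i} := Fintype.card_pos_iff.1 (by omega)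
    have hn₂ : Nonempty {i // ¬p i} := Fintype.card_pos_iff.1 (by omega)
    have hsum : (Fintype.card {i // p i} : ℝ) + Fintype.card {i // ¬p i} = Fintype.card ι := by
      exact_mod_cast (by omega : Fintype.card {i // p i} + Fintype.card {i // ¬p i} = Fintype.card ι)
    have hpos₁ : (0 : ℝ) < Fintype.card {i // p i} := by exact_mod_cast Fintype.card_pos
    have hpos₂ : (0 : ℝ) < Fintype.card {i // ¬p i} := by exact_mod_cast Fintype.card_pos
    have hX₁ := lexp_merge D (κ := {i // p i}) (lam := {i // ¬p i})
      (u := fun i y => g i (glue p y)) (fun i => by fun_prop) (B := B) (fun i y => hB _ _)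
      (fun i y => by simp only [glue_update_left]; exact h0 _ _) hβ0
      (fun i y j x => by
        rw [glue_update_right]
        exact hβ _ _ (fun h => j.2 (h.symm.subst i.2)) _ _)
      (a := 2 * Fintype.card {i // p i} * β * (k + 1)) (by positivity)
      (fun z₂ => ih {i // p i} (by omega) (fun i z => g i (glue p (z, z₂))) (fun i => by fun_prop)
        B (fun _ _ => hB _ _)
        (fun i z => by simp only [glue_update_left p (z, z₂)]; exact h0 _ _) β hβ0
        (fun i j hij z x => by
          rw [glue_update_left p (z, z₂)]
          exact hβ _ _ (fun h => hij (Subtype.ext h)) _ _))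
    have hX₂ := lexp_merge D (κ := {i // ¬p i}) (lam := {i // p i})
      (u := fun i y => g i (glue p y.swap)) (fun i => by fun_prop) (B := B) (fun i y => hB _ _)
      (fun i y => by
        simp only [Prod.swap_prod_mk, glue_update_right p (y.2, y.1)]; exact h0 _ _) hβ0
      (fun i y j x => by
        rw [Prod.swap_prod_mk, glue_update_left p (y.2, y.1)]
        exact hβ _ _ (fun h => i.2 (h.subst j.2)) _ _)
      (a := 2 * Fintype.card {i // ¬p i} * β * (k + 1)) (by positivity)
      (fun z₂ => ih {i // ¬p i} (by omega) (fun i z => g i (glue p (z₂, z))) (fun i => by fun_prop)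
        B (fun _ _ => hB _ _)
        (fun i z => by simp only [glue_update_right p (z₂, z)]; exact h0 _ _) β hβ0
        (fun i j hij z x => by
          rw [glue_update_right p (z₂, z)]
          exact hβ _ _ (fun h => hij (Subtype.ext h)) _ _))
    have hcond₁ : ∀ (i : {i // p i}) (x : Z),
        ∫ w, g i (glue p (Function.update w.1 i x, w.2))
            ∂((Measure.pi fun _ : {i // p i} => D).prod (Measure.pi fun _ : {i // ¬p i} => D))
            = ∫ w, g i (Function.update w i x) ∂(Measure.pi fun _ : ι => D) := fun i x => by
      simp only [glue_update_left]
      rw [integral_pi_eq_integral_glue p D]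
    have hcond₂ : ∀ (i : {i // ¬p i}) (x : Z),
        ∫ w, g i (glue p (Function.update w.1 i x, w.2).swap)
            ∂((Measure.pi fun _ : {i // ¬p i} => D).prod (Measure.pi fun _ : {i // p i} => D))
            = ∫ w, g i (Function.update w i x) ∂(Measure.pi fun _ : ι => D) := fun i x => by
      rw [integral_pi_eq_integral_glue p D, ← integral_prod_swap]
      refine integral_congr_ae (Filter.Eventually.of_forall fun w => ?_)
      simp only [Prod.swap_prod_mk]
      exact congrArg (g i) (glue_update_right p w i x)
    simp only [hcond₁] at hX₁
    simp only [hcond₂] at hX₂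
    have hmc : ∀ i, Measurable fun x : Z =>
        ∫ w, g i (Function.update w i x) ∂(Measure.pi fun _ : ι => D) := fun i => by
      have h1 : Measurable fun q : Z × (ι → Z) => g i (Function.update q.2 i q.1) :=
        (hg i).comp (measurable_update'.comp (measurable_snd.prodMk measurable_fst))
      exact h1.stronglyMeasurable.integral_prod_right'.measurable
    have hX₂' := (lexp_prod_swap (P := Measure.pi fun _ : {i // p i} => D) _).trans_le hX₂
    beta_reduce at hX₂'
    have hmX₁ : Measurable fun y : ({i // p i} → Z) × ({i // ¬p i} → Z) =>
        ∑ i : {i // p i}, (g i (glue p y) -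
          ∫ w, g i (Function.update w i (y.1 i)) ∂(Measure.pi fun _ : ι => D)) :=
      Finset.measurable_fun_sum _ fun i _ => Measurable.sub (by fun_prop)
        ((hmc i).comp ((measurable_pi_apply i).comp measurable_fst))
    have hfin := lexp_div_add hmX₁ (by positivity) (by positivity) hX₁ hX₂'
    rw [lexp_pi_eq_lexp_glue p D]
    refine le_trans (le_of_eq ?_) hfin
    congr 1
    ext y
    congr 2
    · rw [centred, ← Fintype.sum_subtype_add_sum_subtype p]
      congr 1
      · simp
      · simp
    · push_cast
      rw [← hsum]
      ring

end Stability

/-! ### From exponential moments to tail bounds. -/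

section Tail

variable {Ω : Type*} [MeasurableSpace Ω] {μ : Measure Ω}

theorem measure_ge_le_exp {R I : Ω → ℝ} (hR : Measurable R) (hI : Measurable I) {a V l s : ℝ}
    (ha : 0 < a) (hV : 0 ≤ V) (h1 : lexp μ (fun ω => R ω / a - 1) ≤ 1)
    (h2 : ∀ t, lexp μ (fun ω => t * I ω) ≤ ENNReal.ofReal (Real.exp (V * t ^ 2)))
    (hl : 0 < l) (hla : l * a ≤ 1 / 2) :
    μ {ω | a + s ≤ R ω + I ω} ≤ ENNReal.ofReal (Real.exp (2 * V * l ^ 2 - l * s)) := by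
  set θ : ℝ := l * a with hθ
  have hθ0 : 0 < θ := by positivity
  have hθ1 : 0 < 1 - θ := by linarith
  -- R and I may be dependent, so convexity replaces factorization: weight θ = l a on R/a - 1, the
  -- rest on I rescaled by 1/(1 - θ) ≤ 2.
  have hconv := lexp_convex (μ := μ) (X := fun ω => R ω / a - 1) (by fun_prop) hθ0.le hθ1.le
    (by ring) h1 (lexp_sub_const_le_one (h2 (l / (1 - θ))))
  have hle : lexp μ (fun ω => l * (R ω + I ω) - θ - 2 * V * l ^ 2) ≤ 1 := by
    refine (lexp_mono fun ω => ?_).trans hconv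
    have e1 : θ * (R ω / a - 1) = l * R ω - θ := by rw [hθ]; field_simp
    have e2 : (1 - θ) * (l / (1 - θ) * I ω - V * (l / (1 - θ)) ^ 2)
        = l * I ω - V * l ^ 2 / (1 - θ) := by field_simp
    have e3 : V * l ^ 2 / (1 - θ) ≤ 2 * V * l ^ 2 := by
      rw [div_le_iff₀ hθ1]
      have : 0 ≤ V * l ^ 2 := by positivity
      nlinarith
    rw [e1, e2]
    linarith
  have hmk := mul_meas_ge_le_lintegral (μ := μ)
    (f := fun ω => ENNReal.ofReal (Real.exp (l * (R ω + I ω) - θ - 2 * V * l ^ 2)))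
    (by fun_prop) (ENNReal.ofReal (Real.exp (l * s - 2 * V * l ^ 2)))
  have hsub : {ω | a + s ≤ R ω + I ω} ⊆ {ω | ENNReal.ofReal (Real.exp (l * s - 2 * V * l ^ 2))
      ≤ ENNReal.ofReal (Real.exp (l * (R ω + I ω) - θ - 2 * V * l ^ 2))} := fun ω hω => by
    refine ENNReal.ofReal_le_ofReal (Real.exp_le_exp.2 ?_)
    have : l * (a + s) ≤ l * (R ω + I ω) := mul_le_mul_of_nonneg_left hω hl.le
    linarith
  have h3 : ENNReal.ofReal (Real.exp (l * s - 2 * V * l ^ 2)) * μ {ω | a + s ≤ R ω + I ω} ≤ 1 :=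
    (mul_le_mul_right (measure_mono hsub) _).trans (hmk.trans hle)
  have h4 : ENNReal.ofReal (Real.exp (2 * V * l ^ 2 - l * s))
      * ENNReal.ofReal (Real.exp (l * s - 2 * V * l ^ 2)) = 1 := by
    rw [← ENNReal.ofReal_mul (Real.exp_pos _).le, ← Real.exp_add]; simp
  calc μ {ω | a + s ≤ R ω + I ω}
      = ENNReal.ofReal (Real.exp (2 * V * l ^ 2 - l * s))
        * (ENNReal.ofReal (Real.exp (l * s - 2 * V * l ^ 2)) * μ {ω | a + s ≤ R ω + I ω}) := by
        rw [← mul_assoc, h4, one_mul]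
    _ ≤ ENNReal.ofReal (Real.exp (2 * V * l ^ 2 - l * s)) * 1 := by gcongr
    _ = _ := mul_one _

theorem measure_ge_le_of_lexp {R I : Ω → ℝ} (hR : Measurable R) (hI : Measurable I) {a V L : ℝ}
    (ha : 0 < a) (hV : 0 < V) (h1 : lexp μ (fun ω => R ω / a - 1) ≤ 1)
    (h2 : ∀ t, lexp μ (fun ω => t * I ω) ≤ ENNReal.ofReal (Real.exp (V * t ^ 2)))
    (hL : 0 < L) :
    μ {ω | a + (4 * a * L + 2 * Real.sqrt (2 * V * L)) ≤ R ω + I ω}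
      ≤ ENNReal.ofReal (Real.exp (-L)) := by
  set q := Real.sqrt (2 * V * L) with hq
  have hq0 : 0 < q := Real.sqrt_pos.2 (by positivity)
  have hq2 : q ^ 2 = 2 * V * L := Real.sq_sqrt (by positivity)
  have key : ∀ l, 0 < l → l * a ≤ 1 / 2 → 2 * V * l ^ 2 - l * (4 * a * L + 2 * q) ≤ -L →
      μ {ω | a + (4 * a * L + 2 * q) ≤ R ω + I ω} ≤ ENNReal.ofReal (Real.exp (-L)) :=
    fun l hl hla h => (measure_ge_le_exp hR hI ha hV.le h1 h2 hl hla).trans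
      (ENNReal.ofReal_le_ofReal (Real.exp_le_exp.2 h))
  -- Take l = min(q/(2V), 1/(2a)): the first value solves 2Vl² = L, the second is the largest
  -- allowed.
  rcases le_total (q / (2 * V) * a) (1 / 2) with h | h
  · refine key (q / (2 * V)) (by positivity) h ?_
    have e1 : 2 * V * (q / (2 * V)) ^ 2 = L := by
      rw [div_pow, hq2]; field_simp
    have e2 : q / (2 * V) * (2 * q) = 2 * L := by
      have : q / (2 * V) * (2 * q) = 2 * q ^ 2 / (2 * V) := by ring
      rw [this, hq2]; field_simp
    have e3 : 0 ≤ q / (2 * V) * (4 * a * L) := by positivity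
    linarith
  · refine key (1 / (2 * a)) (by positivity) (by field_simp; rfl) ?_
    have e0 : 1 / (2 * a) ≤ q / (2 * V) := by
      rw [div_le_iff₀ (by positivity)]
      linarith
    have e1 : 2 * V * (1 / (2 * a)) ^ 2 ≤ L := by
      calc 2 * V * (1 / (2 * a)) ^ 2 ≤ 2 * V * (q / (2 * V)) ^ 2 := by gcongr
        _ = L := by rw [div_pow, hq2]; field_simp
    have e2 : 1 / (2 * a) * (4 * a * L) = 2 * L := by field_simp; ring
    have e3 : 0 ≤ 1 / (2 * a) * (2 * q) := by positivity
    linarith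

/-- Concentration of sums of weakly dependent, conditionally centred functions of independent
variables. -/
theorem measure_sum_ge_le {Z : Type u} [MeasurableSpace Z] (D : Measure Z) [IsProbabilityMeasure D]
    {ι : Type} [Fintype ι] [DecidableEq ι] [Nonempty ι] {k : ℕ} (hk : Fintype.card ι ≤ 2 ^ k)
    {g : ι → (ι → Z) → ℝ} (hg : ∀ i, Measurable (g i)) {B : ℝ} (hB0 : 0 < B)
    (hB : ∀ i z, |g i z| ≤ B) (h0 : ∀ i z, ∫ x, g i (Function.update z i x) ∂D = 0)
    {β : ℝ} (hβ0 : 0 < β) (hβ : ∀ i j, j ≠ i → ∀ z x, |g i (Function.update z j x) - g i z| ≤ β)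
    {L : ℝ} (hL : 0 < L) :
    (Measure.pi fun _ : ι => D) {z | Fintype.card ι * (2 * β * (k + 1) * (1 + 4 * L))
        + 4 * B * Real.sqrt (Fintype.card ι * L) ≤ ∑ i, g i z}
      ≤ ENNReal.ofReal (Real.exp (-L)) := by
  have hn : (0 : ℝ) < Fintype.card ι := by exact_mod_cast Fintype.card_pos
  set P := Measure.pi fun _ : ι => D with hP
  set e : ι → Z → ℝ := fun i x => ∫ w, g i (Function.update w i x) ∂P with he
  have hgm : ∀ i, Measurable fun q : Z × (ι → Z) => g i (Function.update q.2 i q.1) := fun i =>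
    (hg i).comp (measurable_update'.comp (measurable_snd.prodMk measurable_fst))
  have hem : ∀ i, Measurable (e i) := fun i =>
    (hgm i).stronglyMeasurable.integral_prod_right'.measurable
  have heB : ∀ i x, |e i x| ≤ B := fun i x => abs_integral_le_of_abs_le fun _ => hB _ _
  have he0 : ∀ i, ∫ x, e i x ∂D = 0 := fun i => by
    have hsw : Integrable (Function.uncurry fun (x : Z) (w : ι → Z) =>
        g i (Function.update w i x)) (D.prod P) := integrable_of_abs_le (hgm i) fun _ => hB _ _
    simp only [he]
    rw [integral_integral_swap hsw]
    simp [h0]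
  set I : (ι → Z) → ℝ := fun z => ∑ i, e i (z i) with hI
  have hIm : Measurable I := by fun_prop
  have hI0 : ∫ z, I z ∂P = 0 := by
    have hei : ∀ i, Integrable (fun z : ι → Z => e i (z i)) P := fun i =>
      integrable_of_abs_le ((hem i).comp (measurable_pi_apply i)) fun _ => heB _ _
    simp only [hI]
    rw [integral_finsetSum _ fun i _ => hei i]
    refine Finset.sum_eq_zero fun i _ => ?_
    rw [hP, integral_comp_eval (μ := fun _ : ι => D) (hem i).aestronglyMeasurable, he0]
  have hIβ : ∀ z i x, |I (Function.update z i x) - I z| ≤ 2 * B := fun z i x => by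
    have : I (Function.update z i x) - I z = e i x - e i (z i) := by
      simp only [hI]
      rw [← Finset.sum_sub_distrib, Finset.sum_eq_single i]
      · simp
      · intro j _ hj; simp [Function.update_of_ne hj]
      · simp
    rw [this]
    exact (abs_sub _ _).trans (by linarith [heB i x, heB i (z i)])
  have hIB : ∀ z, |I z| ≤ Fintype.card ι * B := fun z => by
    refine (Finset.abs_sum_le_sum_abs _ _).trans
      ((Finset.sum_le_sum fun i _ => heB i (z i)).trans ?_)
    simp
  have h2 : ∀ t, lexp P (fun z => t * I z)
      ≤ ENNReal.ofReal (Real.exp (2 * Fintype.card ι * B ^ 2 * t ^ 2)) := fun t => by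
    have := lexp_mcdiarmid D _ ι rfl I hIm _ hIB _ hIβ t
    rw [← hP, hI0] at this
    simp only [sub_zero] at this
    refine this.trans (le_of_eq ?_)
    congr 2
    ring
  have h1 := lexp_centred_le D k ι hk g hg B hB h0 β hβ0 hβ
  have hmain := measure_ge_le_of_lexp (measurable_centred D hg) hIm (by positivity)
    (by positivity) h1 h2 hL
  have hsq : Real.sqrt (2 * (2 * Fintype.card ι * B ^ 2) * L)
      = 2 * B * Real.sqrt (Fintype.card ι * L) := by
    rw [show 2 * (2 * Fintype.card ι * B ^ 2) * L = (2 * B) ^ 2 * (Fintype.card ι * L) by ring,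
      Real.sqrt_mul (by positivity), Real.sqrt_sq (by positivity)]
  refine le_trans (le_of_eq ?_) hmain
  congr 1
  ext z
  simp only [Set.mem_ofPred_eq]
  rw [hsq]
  have hz : centred D g z + I z = ∑ i, g i z := by
    rw [centred, ← Finset.sum_add_distrib]
    exact Finset.sum_congr rfl fun i _ => by rw [← hP]; simp [he]
  rw [hz]
  refine iff_of_eq (congrArg (· ≤ _) ?_)
  ring

end Tail

/-! ### Stability, privacy and the generalization gap. -/

section Gap

variable {Z : Type u} [MeasurableSpace Z] (D : Measure Z) [IsProbabilityMeasure D]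

/-- High-probability generalization bound for uniformly stable real-valued predictions. -/
theorem measure_gap_ge_le {N k : ℕ} (hN : 0 < N) (hk : N ≤ 2 ^ k) {f : (Fin N → Z) → Z → ℝ}
    (hf : Measurable (Function.uncurry f)) {M : ℝ} (hM : 0 < M) (hfM : ∀ S z, |f S z| ≤ M)
    {τ : ℝ} (hτ : 0 < τ) (hfτ : ∀ S i x z, |f (Function.update S i x) z - f S z| ≤ τ)
    {L : ℝ} (hL : 0 < L) :
    (Measure.pi fun _ : Fin N => D) {S | 2 * τ + 4 * τ * (k + 1) * (1 + 4 * L)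
        + 8 * M * Real.sqrt (L / N) ≤ ∫ z, f S z ∂D - 1 / N * ∑ i, f S (S i)}
      ≤ ENNReal.ofReal (Real.exp (-L)) := by
  have hN' : (0 : ℝ) < N := by exact_mod_cast hN
  obtain ⟨z₀⟩ := nonempty_of_isProbabilityMeasure D
  have : Nonempty (Fin N) := ⟨⟨0, hN⟩⟩
  have hfm : ∀ S, Measurable (f S) := fun S => hf.comp (by fun_prop : Measurable fun z => (S, z))
  have hfi : ∀ S, Integrable (f S) D := fun S => integrable_of_abs_le (hfm S) (hfM S)
  have hrm : Measurable fun S => ∫ z, f S z ∂D :=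
    hf.stronglyMeasurable.integral_prod_right'.measurable
  have hrM : ∀ S, |∫ z, f S z ∂D| ≤ M := fun S => abs_integral_le_of_abs_le (hfM S)
  have hrτ : ∀ S i x, |∫ z, f (Function.update S i x) z ∂D - ∫ z, f S z ∂D| ≤ τ := fun S i x => by
    rw [← integral_sub (hfi _) (hfi _)]
    exact abs_integral_le_of_abs_le fun z => hfτ S i x z
  -- Once z₀ overwrites the i-th example, S i enters only as the evaluation point, so averaging over
  -- it gives exactly 0.
  set g : Fin N → (Fin N → Z) → ℝ := fun i S =>
    ∫ z, f (Function.update S i z₀) z ∂D - f (Function.update S i z₀) (S i) with hg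
  have hgm : ∀ i, Measurable (g i) := fun i =>
    (hrm.comp measurable_update_left).sub
      (hf.comp (measurable_update_left.prodMk (measurable_pi_apply i)))
  have hgB : ∀ i S, |g i S| ≤ 2 * M := fun i S => by
    have h1 := hrM (Function.update S i z₀)
    have h2 := hfM (Function.update S i z₀) (S i)
    exact (abs_sub _ _).trans (by linarith)
  have hg0 : ∀ i S, ∫ x, g i (Function.update S i x) ∂D = 0 := fun i S => by
    simp only [hg, Function.update_idem, Function.update_self]
    rw [integral_sub (integrable_const _) (hfi _)]
    simp
  have hgβ : ∀ i j, j ≠ i → ∀ S x, |g i (Function.update S j x) - g i S| ≤ 2 * τ := by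
    intro i j hij S x
    simp only [hg, Function.update_of_ne hij.symm, Function.update_comm hij]
    have h1 := abs_le.1 (hrτ (Function.update S i z₀) j x)
    have h2 := abs_le.1 (hfτ (Function.update S i z₀) j x (S i))
    rw [abs_le]
    constructor <;> linarith [h1.1, h1.2, h2.1, h2.2]
  have hmain := measure_sum_ge_le D (by simpa using hk) hgm (by positivity) hgB hg0
    (by positivity : 0 < 2 * τ) hgβ hL
  refine le_trans (measure_mono fun S hS => ?_) hmain
  simp only [Set.mem_ofPred_eq, Fintype.card_fin] at hS ⊢
  have hgap : N * (∫ z, f S z ∂D - 1 / N * ∑ i, f S (S i)) ≤ N * (2 * τ) + ∑ i, g i S := by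
    have : N * (∫ z, f S z ∂D - 1 / N * ∑ i, f S (S i))
        = ∑ i, (∫ z, f S z ∂D - f S (S i)) := by
      rw [Finset.sum_sub_distrib]
      simp
      field_simp
    rw [this]
    have h2 : (N : ℝ) * (2 * τ) = ∑ _i : Fin N, 2 * τ := by simp
    rw [h2, ← Finset.sum_add_distrib]
    refine Finset.sum_le_sum fun i _ => ?_
    have h3 := abs_le.1 (hrτ S i z₀)
    have h4 := abs_le.1 (hfτ S i z₀ (S i))
    simp only [hg]
    linarith [h3.1, h3.2, h4.1, h4.2]
  have hsq : N * Real.sqrt (L / N) = Real.sqrt (N * L) := by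
    rw [show (N : ℝ) * L = N ^ 2 * (L / N) by field_simp, Real.sqrt_mul (by positivity),
      Real.sqrt_sq hN'.le]
  have := mul_le_mul_of_nonneg_left hS hN'.le
  rw [← hsq]
  nlinarith

/-- Layer cake for φ + M, which takes values in [0, 2M]: the level-set estimate is integrated over
an interval of length 2M. -/
theorem integral_sub_integral_le {H : Type v} [MeasurableSpace H] {P Q : Measure H}
    [IsProbabilityMeasure P] [IsProbabilityMeasure Q] {β : ℝ}
    (h : ∀ B, MeasurableSet B → P.real B ≤ Q.real B + β) {φ : H → ℝ} (hφ : Measurable φ) {M : ℝ}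
    (hM : 0 ≤ M) (hφM : ∀ x, |φ x| ≤ M) : ∫ x, φ x ∂P - ∫ x, φ x ∂Q ≤ 2 * M * β := by
  have hb : ∀ x, 0 ≤ φ x + M ∧ φ x + M ≤ 2 * M := fun x => by
    have := abs_le.1 (hφM x)
    constructor <;> linarith
  have hlc : ∀ (ν : Measure H) [IsProbabilityMeasure ν],
      (∫ x, φ x ∂ν) + M = ∫ t in Set.Ioc 0 (2 * M), ν.real {x | t ≤ φ x + M} := fun ν _ => by
    have hi := integrable_of_abs_le (μ := ν) hφ hφM
    have := (hi.add (integrable_const M)).integral_eq_integral_Ioc_meas_le (M := 2 * M)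
      (Filter.Eventually.of_forall fun x => (hb x).1)
      (Filter.Eventually.of_forall fun x => (hb x).2)
    simp only [Pi.add_apply] at this
    rw [← this, integral_add hi (integrable_const M)]
    simp
  have hint : ∀ (ν : Measure H) [IsProbabilityMeasure ν],
      IntegrableOn (fun t : ℝ => ν.real {x | t ≤ φ x + M}) (Set.Ioc 0 (2 * M)) := fun ν _ => by
    refine integrable_of_abs_le (B := 1) (Antitone.measurable fun s t hst =>
      measureReal_mono fun x hx => le_trans hst hx) fun t => ?_
    rw [abs_of_nonneg measureReal_nonneg]
    exact measureReal_le_one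
  have hmono : ∫ t in Set.Ioc 0 (2 * M), P.real {x | t ≤ φ x + M}
      ≤ ∫ t in Set.Ioc 0 (2 * M), (Q.real {x | t ≤ φ x + M} + β) :=
    integral_mono (hint P) ((hint Q).add (integrable_const β)) fun t =>
      h _ (measurableSet_le measurable_const (by fun_prop))
  rw [integral_add (hint Q) (integrable_const β), ← hlc P, ← hlc Q] at hmono
  have : ∫ _t in Set.Ioc 0 (2 * M), β = 2 * M * β := by
    simp [hM]
  linarith

theorem IsDifferentiallyPrivate.abs_integral_sub_le {H : Type v} [MeasurableSpace H] {N : ℕ}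
    {A : Kernel (Fin N → Z) H} [IsMarkovKernel A] {ε δ : ℝ} (hA : IsDifferentiallyPrivate A ε δ)
    (hε : 0 ≤ ε) (hδ : 0 ≤ δ) {φ : H → ℝ} (hφ : Measurable φ) {M : ℝ} (hM : 0 ≤ M)
    (hφM : ∀ x, |φ x| ≤ M) (S : Fin N → Z) (i : Fin N) (x : Z) :
    |∫ h, φ h ∂(A (Function.update S i x)) - ∫ h, φ h ∂(A S)|
      ≤ 2 * M * (1 - Real.exp (-ε) + Real.exp (-ε) * δ) := by
  have hexp : Real.exp (-ε) ≤ 1 := Real.exp_le_one_iff.2 (by linarith)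
  -- Neighbouring samples must genuinely differ, so the trivial replacement is separate.
  by_cases hx : x = S i
  · rw [hx, Function.update_eq_self, sub_self, abs_zero]
    have := Real.exp_pos (-ε)
    have : 0 ≤ 1 - Real.exp (-ε) + Real.exp (-ε) * δ := by
      have := mul_nonneg this.le hδ
      linarith
    positivity
  have htv : ∀ S S', Neighboring S S' → ∀ B, MeasurableSet B →
      (A S).real B ≤ (A S').real B + (1 - Real.exp (-ε) + Real.exp (-ε) * δ) := by
    intro S S' hS B hB
    -- With P and Q the two probabilities of B, P = e^(-ε)P + (1 - e^(-ε))P; privacy bounds the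
    -- first term by Q + e^(-ε)δ, and P ≤ 1 the second.
    have h1 := mul_le_mul_of_nonneg_left (hA S S' hS B hB) (Real.exp_pos (-ε)).le
    have h2 : Real.exp (-ε) * (Real.exp ε * (A S').real B + δ)
        = (A S').real B + Real.exp (-ε) * δ := by
      rw [mul_add, ← mul_assoc, ← Real.exp_add]; simp
    have h3 : (A S).real B ≤ 1 := measureReal_le_one
    nlinarith
  have hn₁ : Neighboring (Function.update S i x) S :=
    ⟨i, by simpa using hx, fun j hj => Function.update_of_ne hj _ _⟩
  have hn₂ : Neighboring S (Function.update S i x) :=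
    ⟨i, by simpa using Ne.symm hx, fun j hj => (Function.update_of_ne hj _ _).symm⟩
  rw [abs_le]
  constructor
  · linarith [integral_sub_integral_le (htv _ _ hn₂) hφ hM hφM]
  · exact integral_sub_integral_le (htv _ _ hn₁) hφ hM hφM

theorem expectedGap_eq {H : Type v} [MeasurableSpace H] {N : ℕ} (A : Kernel (Fin N → Z) H)
    [IsMarkovKernel A] {ℓ : H → Z → ℝ} (hℓ : Measurable (Function.uncurry ℓ)) {M : ℝ}
    (hM : ∀ h z, |ℓ h z| ≤ M) (S : Fin N → Z) :
    expectedGap D ℓ A S = ∫ z, ∫ h, ℓ h z ∂(A S) ∂D - 1 / N * ∑ i, ∫ h, ℓ h (S i) ∂(A S) := by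
  have h1 : ∀ z, Measurable fun h => ℓ h z := fun z =>
    hℓ.comp (by fun_prop : Measurable fun h => (h, z))
  unfold expectedGap risk empiricalRisk
  rw [integral_integral_swap (integrable_of_abs_le hℓ fun _ => hM _ _), integral_const_mul,
    integral_finsetSum _ fun i _ => integrable_of_abs_le (h1 (S i)) fun _ => hM _ _]

theorem clog_add_one_le {N : ℕ} (hN : 2 ≤ N) : (Nat.clog 2 N : ℝ) + 1 ≤ 5 * Real.log N := by
  have h2 := Real.log_two_gt_d9
  have hN' : Real.log 2 ≤ Real.log N := Real.log_le_log (by norm_num) (by exact_mod_cast hN)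
  have hc : 0 < Nat.clog 2 N := Nat.clog_pos (by norm_num) hN
  have h := Nat.pow_pred_clog_lt_self (b := 2) (by norm_num) (x := N) (by omega)
  have h' : Real.log ((2 : ℝ) ^ (Nat.clog 2 N).pred) ≤ Real.log N :=
    Real.log_le_log (by positivity) (by exact_mod_cast h.le)
  rw [Real.log_pow] at h'
  have hp : ((Nat.clog 2 N).pred : ℝ) = Nat.clog 2 N - 1 := by
    rw [Nat.pred_eq_sub_one, Nat.cast_sub hc]; simp
  rw [hp] at h'
  have hc' : (1 : ℝ) ≤ Nat.clog 2 N := by exact_mod_cast hc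
  nlinarith

end Gap

end DPGen

end

/-! ### Assembly and constants. -/

theorem mainTheorem3 :
    ∃ c : ℝ, 0 < c ∧
      ∀ (Z : Type u) [MeasurableSpace Z] (H : Type v) [MeasurableSpace H]
        (D : Measure Z) [IsProbabilityMeasure D]
        (ℓ : H → Z → ℝ) (M : ℝ) (N : ℕ)
        (A : Kernel (Fin N → Z) H) [IsMarkovKernel A] (ε δ γ : ℝ),
        Measurable (Function.uncurry ℓ) →
        0 < M → (∀ h z, |ℓ h z| ≤ M) →
        2 ≤ N → 0 ≤ ε → 0 ≤ δ → 0 < γ → γ < 1 →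
        DPGen.IsDifferentiallyPrivate A ε δ →
        1 - γ ≤ (Measure.pi fun _ : Fin N => D).real
          {S | DPGen.expectedGap D ℓ A S ≤
            c * (M * (1 - Real.exp (-ε) + Real.exp (-ε) * δ) * Real.log N * Real.log (N / γ)
              + M * Real.sqrt (Real.log (1 / γ) / N))} := by
  refine ⟨170, by norm_num, ?_⟩
  intro Z _ H _ D _ ℓ M N A _ ε δ γ hℓ hM hℓM hN hε hδ hγ0 hγ1 hA
  set β : ℝ := 1 - Real.exp (-ε) + Real.exp (-ε) * δ with hβ
  set L : ℝ := Real.log (1 / γ) with hL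
  have hβ0 : 0 ≤ β := by
    have h1 : Real.exp (-ε) ≤ 1 := Real.exp_le_one_iff.2 (by linarith)
    have h2 := mul_nonneg (Real.exp_pos (-ε)).le hδ
    linarith
  have hL0 : 0 < L := Real.log_pos (by rw [lt_div_iff₀ hγ0]; linarith)
  have hN0 : (0 : ℝ) < N := by exact_mod_cast (by omega : 0 < N)
  have hlog2 := Real.log_two_gt_d9
  have hlogN : Real.log 2 ≤ Real.log N := Real.log_le_log (by norm_num) (by exact_mod_cast hN)
  have hlogNγ : Real.log (N / γ) = Real.log N + L := by
    rw [hL, div_eq_mul_one_div, Real.log_mul hN0.ne' (by positivity)]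
  set Q : ℝ := Real.log N * Real.log (N / γ) with hQ
  have hQ4 : 2 / 5 ≤ Q := by rw [hQ, hlogNγ]; nlinarith
  set w : ℝ := M * Real.sqrt (L / N) with hw
  have hw0 : 0 < w := mul_pos hM (Real.sqrt_pos.2 (by positivity))
  -- The extra w/Q keeps τ positive when β = 0. Since the bound multiplies τ by a constant times Q,
  -- it only adds multiples of w.
  set τ : ℝ := 2 * M * β + w / Q with hτ
  have hwQ : 0 < w / Q := by positivity
  have hτ0 : 0 < τ := by positivity
  have hf : Measurable (Function.uncurry fun (S : Fin N → Z) (z : Z) => ∫ h, ℓ h z ∂(A S)) := by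
    have : StronglyMeasurable fun q : ((Fin N → Z) × Z) × H => ℓ q.2 q.1.2 :=
      (hℓ.comp (measurable_snd.prodMk measurable_fst.snd)).stronglyMeasurable
    exact (this.integral_kernel_prod_right' (κ := A.comap Prod.fst measurable_fst)).measurable
  have hℓm : ∀ z, Measurable fun h => ℓ h z := fun z =>
    hℓ.comp (by fun_prop : Measurable fun h => (h, z))
  have hbad := DPGen.measure_gap_ge_le D (by omega) (Nat.le_pow_clog one_lt_two N) hf hM
    (fun S z => DPGen.abs_integral_le_of_abs_le fun h => hℓM h z) hτ0
    (fun S i x z => (hA.abs_integral_sub_le hε hδ (hℓm z) hM.le (fun h => hℓM h z) S i x).trans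
      (by rw [hτ]; linarith)) hL0
  have hexpL : Real.exp (-L) = γ := by
    rw [hL, one_div, Real.log_inv, neg_neg, Real.exp_log hγ0]
  rw [hexpL] at hbad
  have hthr : 2 * τ + 4 * τ * (Nat.clog 2 N + 1) * (1 + 4 * L) + 8 * M * Real.sqrt (L / N)
      ≤ 170 * (M * β * Real.log N * Real.log (N / γ) + w) := by
    have h1 : ((Nat.clog 2 N : ℝ) + 1) * (1 + 4 * L) ≤ (5 * Real.log N) * (4 * Real.log (N / γ)) := by
      refine mul_le_mul (DPGen.clog_add_one_le hN) ?_ (by positivity) (by linarith)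
      rw [hlogNγ]; linarith
    -- The factor is at most 2 + 80Q ≤ 85Q as Q ≥ 2/5; then 85τQ = 170MβQ + 85w, which gives the
    -- constant 170.
    have h2 : τ * (2 + 4 * (((Nat.clog 2 N : ℝ) + 1) * (1 + 4 * L))) ≤ τ * (85 * Q) := by
      refine mul_le_mul_of_nonneg_left ?_ hτ0.le
      rw [hQ] at hQ4 ⊢
      linarith
    have h3 : τ * Q = 2 * (M * β * Real.log N * Real.log (N / γ)) + w := by
      have : w / Q * Q = w := by field_simp
      rw [hτ, add_mul, this, hQ]
      ring
    linarith
  set G := {S | DPGen.expectedGap D ℓ A S ≤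
    170 * (M * β * Real.log N * Real.log (N / γ) + w)} with hG
  have hcompl : (Measure.pi fun _ : Fin N => D).real Gᶜ ≤ γ := by
    refine ENNReal.toReal_le_of_le_ofReal hγ0.le (le_trans (measure_mono fun S hS => ?_) hbad)
    rw [hG, Set.mem_compl_iff, Set.mem_ofPred_eq, not_le, DPGen.expectedGap_eq D A hℓ hℓM] at hS
    exact hthr.trans hS.le
  -- Subadditivity suffices here, so G need not be measurable.
  have hunion := measureReal_union_le (μ := Measure.pi fun _ : Fin N => D) G Gᶜ
  rw [Set.union_compl_self, probReal_univ] at hunion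
  linarith
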